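/- For a finite set $S$ of integers write $S+S=\{a+b : a,b\in S\}$ and $S-S=\{a-b : a,b\in S\}$, and for $S\subseteq[0,n]=\{0,1,\dots,n\}$ let \[ \lambda_n(S)=\bigl(2n+1-|S+S|,\ 2n+1-|S-S|\bigr). \] Let $\Lambda\subseteq\mathbb{Z}_{\ge 0}\times\mathbb{Z}_{\ge 0}$ contain at least one pair $(s,d)$ with $d$ even, and let $(\alpha_n)$ be a sequence of integers such that $0<\alpha_n<n/2$ for all sufficiently large $n$ and $\alpha_n\to\infty$ as $n\to\infty$. For each $n$ let $S_n$ be a uniformly random subset of $[0,n]$ and let $E_n$ be an event determined by $S_n$ which, for all sufficiently large $n$, depends only on $S_n\cap[\alpha_n+1,\,n-\alpha_n-1]$. Suppose that $\lim_{n\to\infty}\mathbb{P}(E_n)$ exists. Then $\mathbb{P}(\lambda_n(S_n)\in\Lambda)>0$ for all sufficiently large $n$ (so that the conditional probabilities below are defined), and \[ \lim_{n\to\infty}\mathbb{P}\bigl(E_n \mid \lambda_n(S_n)\in\Lambda\bigr)=\lim_{n\to\infty}\mathbb{P}(E_n). \] -/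

import Mathlib

open Filter Topology MeasureTheory ProbabilityTheory
open scoped Pointwise

/-- All sets of finite sets of integers are events. -/
instance Finset.instMeasurableSpaceIntTop : MeasurableSpace (Finset ℤ) := ⊤

/-- The law of a uniform random subset `S` of `[0, n] = {0, 1, …, n}`: each of the `2 ^ (n + 1)`
subsets of `[0, n]` has the same probability. -/
noncomputable def uniformSubset (n : ℕ) : Measure (Finset ℤ) :=
  uniformOn {S : Finset ℤ | S ⊆ Finset.Icc 0 (n : ℤ)}

/-- `λ_n(S) = (2n + 1 - |S + S|, 2n + 1 - |S - S|)`, the numbers of missing sums and of missing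
differences of a set `S ⊆ [0, n]`. By `card_add_le_of_subset` and `card_sub_le_of_subset` the
subtractions of natural numbers are not truncated for `S ⊆ [0, n]`. -/
def missing (n : ℕ) (S : Finset ℤ) : ℕ × ℕ :=
  (2 * n + 1 - (S + S).card, 2 * n + 1 - (S - S).card)

theorem card_add_le_of_subset {n : ℕ} {S : Finset ℤ} (hS : S ⊆ Finset.Icc 0 (n : ℤ)) :
    (S + S).card ≤ 2 * n + 1 := by
  have h : S + S ⊆ Finset.Icc 0 (2 * (n : ℤ)) := by
    intro x hx
    obtain ⟨a, ha, b, hb, rfl⟩ := Finset.mem_add.1 hx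
    have h1 := Finset.mem_Icc.1 (hS ha)
    have h2 := Finset.mem_Icc.1 (hS hb)
    exact Finset.mem_Icc.2 ⟨by omega, by omega⟩
  have h' := Finset.card_le_card h
  rw [Int.card_Icc] at h'
  omega

theorem card_sub_le_of_subset {n : ℕ} {S : Finset ℤ} (hS : S ⊆ Finset.Icc 0 (n : ℤ)) :
    (S - S).card ≤ 2 * n + 1 := by
  have h : S - S ⊆ Finset.Icc (-(n : ℤ)) n := by
    intro x hx
    obtain ⟨a, ha, b, hb, rfl⟩ := Finset.mem_sub.1 hx
    have h1 := Finset.mem_Icc.1 (hS ha)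
    have h2 := Finset.mem_Icc.1 (hS hb)
    exact Finset.mem_Icc.2 ⟨by omega, by omega⟩
  have h' := Finset.card_le_card h
  rw [Int.card_Icc] at h'
  omega

/-- The event `{λ_n(S) ∈ Λ}`. -/
def missingIn (n : ℕ) (L : Set (ℕ × ℕ)) : Set (Finset ℤ) :=
  {S | missing n S ∈ L}

/-- The event `E` about a random subset `S` of `[0, n]` depends only on `S ∩ J`: for all possible
values `S`, `T ⊆ [0, n]` with `S ∩ J = T ∩ J`, the event holds for `S` iff it holds for `T`. -/
def DependsOnlyOnInter (n : ℕ) (J : Finset ℤ) (E : Set (Finset ℤ)) : Prop :=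
  ∀ S T : Finset ℤ, S ⊆ Finset.Icc 0 (n : ℤ) → T ⊆ Finset.Icc 0 (n : ℤ) →
    S ∩ J = T ∩ J → (S ∈ E ↔ T ∈ E)

/-! A uniform random set almost always attains every sum and difference away from the extremes: an
element at distance `y` from the extreme has about `y / 2` disjoint representations, each absent
with probability `3 / 4`, so a union bound gives a geometric tail in the cut-off `k`, uniform in `n`
(`uniformPowerset_real_not_centrallyFull_le`). For such a set, the missing counts depend only on the
elements within `k` of the ends, because extreme sums and differences use only those
(`missing_eq_of_subset`). The event `E n` sees only the middle, which is disjoint from this fringe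
once `α n ≥ k`. Hence the two events are independent up to an error `2 * ε`
(`abs_uniformPowerset_real_inter_sub_mul_le`).

To divide by the probability of the conditioning event, it must stay bounded below. It suffices to
realise one pair `(s, 2 * e)` by fixed end patterns `A` and `B` (`exists_fringePair`): prescribing
boundedly many elements costs a constant factor, and the middle remains random
(`FringePair.exists_le_uniformPowerset_real`). -/

/-! ### Counting subsets and the uniform law -/

open Classical in
/-- The number of subsets of `U` with the property `p`. -/
noncomputable def subsetCount (U : Finset ℤ) (p : Finset ℤ → Prop) : ℕ :=
  (U.powerset.filter p).card

/-- The law of a uniform random subset of `U`. -/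
noncomputable def uniformPowerset (U : Finset ℤ) : Measure (Finset ℤ) :=
  uniformOn {S : Finset ℤ | S ⊆ U}

theorem coe_powerset_eq (U : Finset ℤ) : {S : Finset ℤ | S ⊆ U} = (U.powerset : Set (Finset ℤ)) := by
  ext S
  simp

instance (U : Finset ℤ) : IsProbabilityMeasure (uniformPowerset U) := by
  refine isProbabilityMeasure_uniformOn ?_ ⟨∅, Finset.empty_subset U⟩
  rw [coe_powerset_eq]
  exact Finset.finite_toSet _

theorem uniformPowerset_real (U : Finset ℤ) (p : Finset ℤ → Prop) :
    (uniformPowerset U).real {S | p S} = subsetCount U p / 2 ^ U.card := by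
  classical
  have hfin : ((U.powerset : Set (Finset ℤ))).Finite := Finset.finite_toSet _
  have h1 : uniformPowerset U {S | p S}
      = uniformOn (U.powerset : Set (Finset ℤ)) (U.powerset.filter p : Finset (Finset ℤ)) := by
    rw [uniformPowerset, coe_powerset_eq, ← uniformOn_inter_self hfin]
    congr 1
    ext S
    simp
  rw [measureReal_def, h1, uniformOn_apply_finset, Finset.inter_eq_right.2 (Finset.filter_subset _ _),
    Finset.card_powerset, ENNReal.toReal_div]
  simp [subsetCount]

theorem subsetCount_mono {U : Finset ℤ} {p q : Finset ℤ → Prop} (h : ∀ S ⊆ U, p S → q S) :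
    subsetCount U p ≤ subsetCount U q := by
  classical
  refine Finset.card_le_card fun S hS => ?_
  simp only [Finset.mem_filter, Finset.mem_powerset] at hS ⊢
  exact ⟨hS.1, h S hS.1 hS.2⟩

theorem subsetCount_congr {U : Finset ℤ} {p q : Finset ℤ → Prop} (h : ∀ S ⊆ U, p S ↔ q S) :
    subsetCount U p = subsetCount U q :=
  le_antisymm (subsetCount_mono fun S hS => (h S hS).1) (subsetCount_mono fun S hS => (h S hS).2)

theorem subsetCount_true (U : Finset ℤ) : subsetCount U (fun _ => True) = 2 ^ U.card := by
  simp [subsetCount]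

theorem subsetCount_inter_sdiff {U J : Finset ℤ} (hJ : J ⊆ U) (p q : Finset ℤ → Prop) :
    subsetCount U (fun S => p (S ∩ J) ∧ q (S \ J)) = subsetCount J p * subsetCount (U \ J) q := by
  classical
  rw [subsetCount, subsetCount, subsetCount, ← Finset.card_product]
  refine Finset.card_bij' (fun S _ => (S ∩ J, S \ J)) (fun T _ => T.1 ∪ T.2) ?_ ?_ ?_ ?_
  · intro S hS
    simp only [Finset.mem_filter, Finset.mem_powerset, Finset.mem_product] at hS ⊢
    exact ⟨⟨Finset.inter_subset_right, hS.2.1⟩, Finset.sdiff_subset_sdiff hS.1 le_rfl, hS.2.2⟩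
  · rintro ⟨A, B⟩ hT
    simp only [Finset.mem_filter, Finset.mem_powerset, Finset.mem_product] at hT ⊢
    obtain ⟨⟨hA, hp⟩, hB, hq⟩ := hT
    have hd : ∀ x ∈ B, x ∉ J := fun x hx => (Finset.mem_sdiff.1 (hB hx)).2
    have h1 : (A ∪ B) ∩ J = A := by
      ext x
      have := hd x
      have := @hA x
      simp only [Finset.mem_inter, Finset.mem_union]
      tauto
    have h2 : (A ∪ B) \ J = B := by
      ext x
      have := hd x
      have := @hA x
      simp only [Finset.mem_sdiff, Finset.mem_union]
      tauto
    rw [h1, h2]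
    exact ⟨Finset.union_subset (hA.trans hJ) (hB.trans Finset.sdiff_subset), hp, hq⟩
  · intro S _
    ext x
    simp only [Finset.mem_union, Finset.mem_inter, Finset.mem_sdiff]
    tauto
  · rintro ⟨A, B⟩ hT
    simp only [Finset.mem_filter, Finset.mem_powerset, Finset.mem_product] at hT
    obtain ⟨⟨hA, -⟩, hB, -⟩ := hT
    have hd : ∀ x ∈ B, x ∉ J := fun x hx => (Finset.mem_sdiff.1 (hB hx)).2
    refine Prod.ext ?_ ?_
    · ext x
      have := hd x
      have := @hA x
      simp only [Finset.mem_inter, Finset.mem_union]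
      tauto
    · ext x
      have := hd x
      have := @hA x
      simp only [Finset.mem_sdiff, Finset.mem_union]
      tauto

/-- Events that depend on the traces of a uniform random set on disjoint sets are independent. -/
theorem uniformPowerset_real_inter {U J : Finset ℤ} (hJ : J ⊆ U) {p q : Finset ℤ → Prop}
    (hp : ∀ S ⊆ U, p S ↔ p (S ∩ J)) (hq : ∀ S ⊆ U, q S ↔ q (S \ J)) :
    (uniformPowerset U).real {S | p S ∧ q S}
      = (uniformPowerset U).real {S | p S} * (uniformPowerset U).real {S | q S} := by
  have h1 : subsetCount U (fun S => p S ∧ q S) = subsetCount J p * subsetCount (U \ J) q := by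
    rw [← subsetCount_inter_sdiff hJ]
    exact subsetCount_congr fun S hS => and_congr (hp S hS) (hq S hS)
  have h2 : subsetCount U p = subsetCount J p * 2 ^ (U \ J).card := by
    rw [← subsetCount_true, ← subsetCount_inter_sdiff hJ]
    exact subsetCount_congr fun S hS => by rw [hp S hS, and_true]
  have h3 : subsetCount U q = 2 ^ J.card * subsetCount (U \ J) q := by
    rw [← subsetCount_true, ← subsetCount_inter_sdiff hJ]
    exact subsetCount_congr fun S hS => by rw [hq S hS, true_and]
  have h4 : U.card = (U \ J).card + J.card := (Finset.card_sdiff_add_card_eq_card hJ).symm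
  rw [uniformPowerset_real, uniformPowerset_real, uniformPowerset_real, h1, h2, h3, h4, pow_add]
  push_cast
  field_simp

/-- Prescribing the trace on `F` costs at most a factor `2 ^ |F|` in probability. -/
theorem uniformPowerset_real_le_of_replace {U F S₀ : Finset ℤ} (hF : F ⊆ U)
    {p q : Finset ℤ → Prop} (h : ∀ S ⊆ U, p S → q (S \ F ∪ S₀ ∩ F)) :
    (uniformPowerset U).real {S | p S} ≤ 2 ^ F.card * (uniformPowerset U).real {S | q S} := by
  classical
  have hc : subsetCount U p ≤ subsetCount F (fun _ => True)
      * subsetCount (U \ F) (fun S => q (S ∪ S₀ ∩ F)) := by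
    rw [← subsetCount_inter_sdiff hF]
    exact subsetCount_mono fun S hS hp => ⟨trivial, h S hS hp⟩
  -- The added trace `S₀ ∩ F` is fixed and disjoint from `U \ F`, so adding it loses no information.
  have hc' : subsetCount (U \ F) (fun S => q (S ∪ S₀ ∩ F)) ≤ subsetCount U q := by
    refine Finset.card_le_card_of_injOn (fun S => S ∪ S₀ ∩ F) ?_ ?_
    · intro S hS
      simp only [Finset.coe_filter, Finset.mem_powerset, Set.mem_ofPred_eq] at hS ⊢
      exact ⟨Finset.union_subset (hS.1.trans Finset.sdiff_subset)
        (Finset.inter_subset_right.trans hF), hS.2⟩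
    · intro S hS T hT hST
      simp only [Finset.coe_filter, Finset.mem_powerset, Set.mem_ofPred_eq] at hS hT
      have h1 : ∀ S ⊆ U \ F, (S ∪ S₀ ∩ F) \ F = S := by
        intro S hS
        ext x
        have := @hS x
        simp only [Finset.mem_sdiff, Finset.mem_union, Finset.mem_inter] at this ⊢
        tauto
      rw [← h1 S hS.1, ← h1 T hT.1]
      exact congrArg (· \ F) hST
  rw [subsetCount_true] at hc
  rw [uniformPowerset_real, uniformPowerset_real, ← mul_div_assoc]
  gcongr
  exact_mod_cast hc.trans (Nat.mul_le_mul_left _ hc')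

/-! ### Avoiding disjoint pairs -/

/-- Each pair excludes one of its four traces, and disjointness makes the traces independent;
induction splits off one pair at a time. -/
theorem subsetCount_pairs_le {ι : Type*} (P : Finset ι) (f g : ι → ℤ) (U : Finset ℤ)
    (hfU : ∀ i ∈ P, f i ∈ U) (hgU : ∀ i ∈ P, g i ∈ U)
    (hf : Set.InjOn f P) (hg : Set.InjOn g P) (hfg : ∀ i ∈ P, ∀ j ∈ P, f i ≠ g j) :
    4 ^ P.card * subsetCount U (fun S => ∀ i ∈ P, f i ∈ S → g i ∉ S) ≤ 3 ^ P.card * 2 ^ U.card := by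
  classical
  induction P using Finset.induction_on generalizing U with
  | empty => simp [subsetCount_true]
  | insert a P ha ih =>
    have hfa : f a ∈ U := hfU a (Finset.mem_insert_self _ _)
    have hga : g a ∈ U := hgU a (Finset.mem_insert_self _ _)
    have hne : f a ≠ g a := hfg _ (Finset.mem_insert_self _ _) _ (Finset.mem_insert_self _ _)
    have hJ : {f a, g a} ⊆ U := by
      intro x hx
      simp only [Finset.mem_insert, Finset.mem_singleton] at hx
      rcases hx with rfl | rfl <;> assumption
    have hff : ∀ i ∈ P, f i ≠ f a := fun i hi h =>
      ha (hf (Finset.mem_insert_of_mem hi) (Finset.mem_insert_self _ _) h ▸ hi)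
    have hgg : ∀ i ∈ P, g i ≠ g a := fun i hi h =>
      ha (hg (Finset.mem_insert_of_mem hi) (Finset.mem_insert_self _ _) h ▸ hi)
    have hfg' : ∀ i ∈ P, f i ≠ g a := fun i hi =>
      hfg _ (Finset.mem_insert_of_mem hi) _ (Finset.mem_insert_self _ _)
    have hgf' : ∀ i ∈ P, g i ≠ f a := fun i hi =>
      (hfg _ (Finset.mem_insert_self _ _) _ (Finset.mem_insert_of_mem hi)).symm
    have hcount : subsetCount U (fun S => ∀ i ∈ insert a P, f i ∈ S → g i ∉ S)
        ≤ subsetCount {f a, g a} (fun S => S ≠ {f a, g a})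
          * subsetCount (U \ {f a, g a}) (fun S => ∀ i ∈ P, f i ∈ S → g i ∉ S) := by
      rw [← subsetCount_inter_sdiff hJ]
      refine subsetCount_mono fun S _ hp => ⟨fun h => ?_, fun i hi h1 h2 => ?_⟩
      · have h1 : f a ∈ S ∩ {f a, g a} := by rw [h]; simp
        have h2 : g a ∈ S ∩ {f a, g a} := by rw [h]; simp
        exact hp a (Finset.mem_insert_self _ _) (Finset.mem_inter.1 h1).1 (Finset.mem_inter.1 h2).1
      · exact hp i (Finset.mem_insert_of_mem hi) (Finset.mem_sdiff.1 h1).1 (Finset.mem_sdiff.1 h2).1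
    have h3 : subsetCount {f a, g a} (fun S => S ≠ {f a, g a}) = 3 := by
      have : ({f a, g a} : Finset ℤ).powerset.filter (fun S => S ≠ {f a, g a})
          = ({f a, g a} : Finset ℤ).powerset.erase {f a, g a} := by
        ext S
        simp [and_comm]
      rw [subsetCount]
      convert congrArg Finset.card this
      rw [Finset.card_erase_of_mem (by simp), Finset.card_powerset, Finset.card_pair hne]
      norm_num
    have hIH := ih (U \ {f a, g a})
      (fun i hi => by simp [hfU i (Finset.mem_insert_of_mem hi), hff i hi, hfg' i hi])
      (fun i hi => by simp [hgU i (Finset.mem_insert_of_mem hi), hgg i hi, hgf' i hi])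
      (hf.mono (by simp)) (hg.mono (by simp))
      (fun i hi j hj => hfg i (Finset.mem_insert_of_mem hi) j (Finset.mem_insert_of_mem hj))
    have hU : U.card = (U \ {f a, g a}).card + 2 := by
      rw [← Finset.card_sdiff_add_card_eq_card hJ, Finset.card_pair hne]
    rw [h3] at hcount
    rw [Finset.card_insert_of_notMem ha, hU, pow_add, pow_add, pow_add]
    calc _ ≤ 4 ^ P.card * 4 ^ 1 * (3 * subsetCount (U \ {f a, g a})
          (fun S => ∀ i ∈ P, f i ∈ S → g i ∉ S)) := Nat.mul_le_mul_left _ hcount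
      _ = 12 * (4 ^ P.card * subsetCount (U \ {f a, g a})
          (fun S => ∀ i ∈ P, f i ∈ S → g i ∉ S)) := by ring
      _ ≤ 12 * (3 ^ P.card * 2 ^ (U \ {f a, g a}).card) := Nat.mul_le_mul_left _ hIH
      _ = _ := by ring

/-- A uniform random set contains none of `m` disjoint pairs with probability at most
`(3 / 4) ^ m`. -/
theorem uniformPowerset_real_pairs_le {ι : Type*} (P : Finset ι) (f g : ι → ℤ) (U : Finset ℤ)
    (hfU : ∀ i ∈ P, f i ∈ U) (hgU : ∀ i ∈ P, g i ∈ U)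
    (hf : Set.InjOn f P) (hg : Set.InjOn g P) (hfg : ∀ i ∈ P, ∀ j ∈ P, f i ≠ g j) :
    (uniformPowerset U).real {S | ∀ i ∈ P, f i ∈ S → g i ∉ S} ≤ (3 / 4 : ℝ) ^ P.card := by
  have h := subsetCount_pairs_le P f g U hfU hgU hf hg hfg
  rw [uniformPowerset_real, div_pow, div_le_div_iff₀ (by positivity) (by positivity), mul_comm]
  exact_mod_cast h

/-! ### Central sums and differences are almost surely attained -/

/-- Among the elements of `S` in `[a, b]` all sums at distance at least `k` from the extreme sums
`2 * a`, `2 * b`, and all positive differences at distance at least `k` from the extreme difference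
`b - a`, are attained. -/
def CentrallyFull (a b : ℤ) (k : ℕ) (S : Finset ℤ) : Prop :=
  (∀ x, 2 * a + k ≤ x → x ≤ 2 * b - k →
    ∃ u ∈ S, x - u ∈ S ∧ a ≤ u ∧ u ≤ b ∧ a ≤ x - u ∧ x - u ≤ b) ∧
  ∀ x, 1 ≤ x → x ≤ b - a - k → ∃ u ∈ S, u + x ∈ S ∧ a ≤ u ∧ u + x ≤ b

/-- Pairs `(t, t + x)` overlap in chains. Cutting into blocks of length `x` and keeping `t` in even
blocks makes them disjoint; shifting by `x` sends odd blocks into even ones, so at least half of the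
pairs survive. -/
theorem le_two_mul_card_filter_even_div (x m : ℕ) (hx : 0 < x) :
    m ≤ 2 * ((Finset.range m).filter (fun t => t / x % 2 = 0)).card := by
  have h1 := Finset.card_filter_add_card_filter_not (s := Finset.range m)
    (fun t => t / x % 2 = 0)
  have h2 : ((Finset.range m).filter (fun t => ¬ t / x % 2 = 0)).card
      ≤ ((Finset.range m).filter (fun t => t / x % 2 = 0)).card := by
    have key : ∀ t, ¬ t / x % 2 = 0 → x ≤ t := by
      intro t ht
      by_contra hlt
      rw [Nat.div_eq_of_lt (by omega)] at ht
      omega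
    refine Finset.card_le_card_of_injOn (fun t => t - x) ?_ ?_
    · intro t ht
      simp only [Finset.coe_filter, Finset.mem_range, Set.mem_ofPred_eq] at ht ⊢
      have h3 := key t ht.2
      have h4 := Nat.add_div_right (t - x) hx
      rw [Nat.sub_add_cancel h3] at h4
      omega
    · intro s hs t ht hst
      simp only [Finset.coe_filter, Finset.mem_range, Set.mem_ofPred_eq] at hs ht hst
      have := key s hs.2
      have := key t ht.2
      omega
  rw [Finset.card_range] at h1
  omega

theorem uniformPowerset_real_low_sum_le {U : Finset ℤ} {a b : ℤ} (hU : Finset.Icc a b ⊆ U)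
    (y : ℕ) (hy : (y : ℤ) ≤ b - a) :
    (uniformPowerset U).real {S | ∀ t ∈ Finset.range (y / 2), a + t ∈ S → a + y - (t : ℤ) ∉ S}
      ≤ (3 / 4 : ℝ) ^ (y / 2) := by
  refine (uniformPowerset_real_pairs_le _ (fun t : ℕ => a + t) (fun t : ℕ => a + y - t) U
    ?_ ?_ ?_ ?_ ?_).trans_eq (by rw [Finset.card_range])
  · intro t ht
    rw [Finset.mem_range] at ht
    exact hU (Finset.mem_Icc.2 ⟨by omega, by omega⟩)
  · intro t ht
    rw [Finset.mem_range] at ht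
    exact hU (Finset.mem_Icc.2 ⟨by omega, by omega⟩)
  · intro s _ t _ h
    simpa using h
  · intro s _ t _ h
    simpa using h
  · intro s hs t ht
    rw [Finset.mem_range] at hs ht
    omega

theorem uniformPowerset_real_high_sum_le {U : Finset ℤ} {a b : ℤ} (hU : Finset.Icc a b ⊆ U)
    (y : ℕ) (hy : (y : ℤ) ≤ b - a) :
    (uniformPowerset U).real {S | ∀ t ∈ Finset.range (y / 2), b - t ∈ S → b - y + (t : ℤ) ∉ S}
      ≤ (3 / 4 : ℝ) ^ (y / 2) := by
  refine (uniformPowerset_real_pairs_le _ (fun t : ℕ => b - t) (fun t : ℕ => b - y + t) U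
    ?_ ?_ ?_ ?_ ?_).trans_eq (by rw [Finset.card_range])
  · intro t ht
    rw [Finset.mem_range] at ht
    exact hU (Finset.mem_Icc.2 ⟨by omega, by omega⟩)
  · intro t ht
    rw [Finset.mem_range] at ht
    exact hU (Finset.mem_Icc.2 ⟨by omega, by omega⟩)
  · intro s _ t _ h
    simpa using h
  · intro s _ t _ h
    simpa using h
  · intro s hs t ht
    rw [Finset.mem_range] at hs ht
    omega

theorem uniformPowerset_real_difference_le {U : Finset ℤ} {a b : ℤ} (hU : Finset.Icc a b ⊆ U)
    (x y : ℕ) (hx : 0 < x) (hxy : (x + y : ℤ) = b - a) :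
    (uniformPowerset U).real {S | ∀ t ∈ (Finset.range (y + 1)).filter (fun t => t / x % 2 = 0),
      a + t ∈ S → a + t + (x : ℤ) ∉ S} ≤ (3 / 4 : ℝ) ^ (y / 2) := by
  have hc := le_two_mul_card_filter_even_div x (y + 1) hx
  refine (uniformPowerset_real_pairs_le _ (fun t : ℕ => a + t) (fun t : ℕ => a + t + x) U
    ?_ ?_ ?_ ?_ ?_).trans
    (pow_le_pow_of_le_one (by norm_num) (by norm_num) (by omega))
  · intro t ht
    rw [Finset.mem_filter, Finset.mem_range] at ht
    exact hU (Finset.mem_Icc.2 ⟨by omega, by omega⟩)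
  · intro t ht
    rw [Finset.mem_filter, Finset.mem_range] at ht
    exact hU (Finset.mem_Icc.2 ⟨by omega, by omega⟩)
  · intro s _ t _ h
    simpa using h
  · intro s _ t _ h
    simpa using h
  · intro s hs t ht h
    rw [Finset.mem_filter] at hs ht
    have h1 : s = t + x := by
      have : a + (s : ℤ) = a + t + x := h
      omega
    have h2 := Nat.add_div_right t hx
    rw [← h1] at h2
    omega

theorem three_quarters_pow_half_le (y : ℕ) : (3 / 4 : ℝ) ^ (y / 2) ≤ 8 / 7 * (7 / 8) ^ y := by
  -- `49 / 64 = (7 / 8) ^ 2` is a convenient square above `3 / 4`.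
  have h1 : (3 / 4 : ℝ) ^ (y / 2) ≤ (49 / 64) ^ (y / 2) := 
    pow_le_pow_left₀ (by norm_num) (by norm_num) _
  have h2 : (49 / 64 : ℝ) ^ (y / 2) = (7 / 8) ^ (2 * (y / 2)) := by rw [pow_mul]; norm_num
  have h3 : (7 / 8 : ℝ) ^ (2 * (y / 2) + 1) ≤ (7 / 8) ^ y :=
    pow_le_pow_of_le_one (by norm_num) (by norm_num) (by omega)
  have h4 : (7 / 8 : ℝ) ^ (y + 0) = (7 / 8) ^ y := by simp
  rw [pow_succ] at h3
  linarith [h2 ▸ h1]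

theorem uniformPowerset_real_not_centrallyFull_le {U : Finset ℤ} {a b : ℤ}
    (hU : Finset.Icc a b ⊆ U) (k : ℕ) :
    (uniformPowerset U).real {S | ¬ CentrallyFull a b k S} ≤ 28 * (7 / 8 : ℝ) ^ k := by
  classical
  set w : ℕ := (b - a).toNat with hw
  let L : ℕ → Set (Finset ℤ) := fun y =>
    {S | ∀ t ∈ Finset.range (y / 2), a + t ∈ S → a + y - (t : ℤ) ∉ S}
  let H : ℕ → Set (Finset ℤ) := fun y =>
    {S | ∀ t ∈ Finset.range (y / 2), b - t ∈ S → b - y + (t : ℤ) ∉ S}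
  let D : ℕ → Set (Finset ℤ) := fun y =>
    {S | 0 < w - y ∧ ∀ t ∈ (Finset.range (y + 1)).filter (fun t => t / (w - y) % 2 = 0),
      a + t ∈ S → a + t + ((w - y : ℕ) : ℤ) ∉ S}
  -- Here `y` is the distance to an extreme: sums up to `a + b` are measured from `2 * a`, the
  -- others from `2 * b`, and the difference `w - y` from `w`.
  have hmono : {S | ¬ CentrallyFull a b k S} ⊆ ⋃ y ∈ Finset.Ico k (w + 1), (L y ∪ H y ∪ D y) := by
    intro S hS
    by_contra hcon
    simp only [Set.mem_iUnion, not_exists, Finset.mem_Ico, Set.mem_union, not_or] at hcon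
    refine hS ⟨fun x hx1 hx2 => ?_, fun x hx1 hx2 => ?_⟩
    · by_cases hlow : x ≤ a + b
      · obtain ⟨⟨h, -⟩, -⟩ := hcon (x - 2 * a).toNat ⟨by omega, by omega⟩
        simp only [L, Set.mem_ofPred_eq, not_forall, not_not, Finset.mem_range] at h
        obtain ⟨t, ht, h1, h2⟩ := h
        have : a + ((x - 2 * a).toNat : ℤ) - t = x - (a + t) := by omega
        rw [this] at h2
        exact ⟨a + t, h1, h2, by omega, by omega, by omega, by omega⟩
      · obtain ⟨⟨-, h⟩, -⟩ := hcon (2 * b - x).toNat ⟨by omega, by omega⟩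
        simp only [H, Set.mem_ofPred_eq, not_forall, not_not, Finset.mem_range] at h
        obtain ⟨t, ht, h1, h2⟩ := h
        have : b - ((2 * b - x).toNat : ℤ) + t = x - (b - t) := by omega
        rw [this] at h2
        exact ⟨b - t, h1, h2, by omega, by omega, by omega, by omega⟩
    · obtain ⟨-, h⟩ := hcon (b - a - x).toNat ⟨by omega, by omega⟩
      have hpos : 0 < w - (b - a - x).toNat := by omega
      simp only [D, Set.mem_ofPred_eq, not_and, not_forall, not_not, Finset.mem_filter,
        Finset.mem_range] at h
      obtain ⟨t, ⟨ht, -⟩, h1, h2⟩ := h hpos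
      have : ((w - (b - a - x).toNat : ℕ) : ℤ) = x := by omega
      rw [this] at h2
      exact ⟨a + t, h1, h2, by omega, by omega⟩
  have hterm : ∀ y ∈ Finset.Ico k (w + 1),
      (uniformPowerset U).real (L y ∪ H y ∪ D y) ≤ 3 * (8 / 7 * (7 / 8) ^ y) := by
    intro y hy
    rw [Finset.mem_Ico] at hy
    have hq := three_quarters_pow_half_le y
    by_cases hab : a ≤ b
    · have hL : (uniformPowerset U).real (L y) ≤ (3 / 4 : ℝ) ^ (y / 2) :=
        uniformPowerset_real_low_sum_le hU y (by omega)
      have hH : (uniformPowerset U).real (H y) ≤ (3 / 4 : ℝ) ^ (y / 2) :=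
        uniformPowerset_real_high_sum_le hU y (by omega)
      have hD : (uniformPowerset U).real (D y) ≤ (3 / 4 : ℝ) ^ (y / 2) := by
        by_cases hpos : 0 < w - y
        · exact (measureReal_mono fun S hS => hS.2).trans
            (uniformPowerset_real_difference_le hU (w - y) y hpos (by omega))
        · have : D y = ∅ := Set.eq_empty_of_forall_notMem fun S hS => hpos hS.1
          rw [this, measureReal_empty]
          positivity
      have h1 := measureReal_union_le (μ := uniformPowerset U) (L y ∪ H y) (D y)
      have h2 := measureReal_union_le (μ := uniformPowerset U) (L y) (H y)
      linarith
    -- The interval is empty, so only `y = 0` occurs and the claimed bound exceeds 1.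
    · have hy0 : y = 0 := by omega
      have h1 : (uniformPowerset U).real (L y ∪ H y ∪ D y) ≤ 1 := measureReal_le_one
      subst hy0
      norm_num
      linarith
  calc (uniformPowerset U).real {S | ¬ CentrallyFull a b k S}
      ≤ (uniformPowerset U).real (⋃ y ∈ Finset.Ico k (w + 1), (L y ∪ H y ∪ D y)) :=
        measureReal_mono hmono (measure_ne_top _ _)
    _ ≤ ∑ y ∈ Finset.Ico k (w + 1), (uniformPowerset U).real (L y ∪ H y ∪ D y) :=
        measureReal_biUnion_finset_le _ _
    _ ≤ ∑ y ∈ Finset.Ico k (w + 1), 3 * (8 / 7 * (7 / 8 : ℝ) ^ y) := Finset.sum_le_sum hterm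
    _ = 24 / 7 * ∑ y ∈ Finset.Ico k (w + 1), (7 / 8 : ℝ) ^ y := by
        rw [Finset.mul_sum]
        exact Finset.sum_congr rfl fun y _ => by ring
    _ ≤ 24 / 7 * ((7 / 8) ^ k / (1 - 7 / 8)) := by
        gcongr
        exact geom_sum_Ico_le_of_lt_one (by norm_num) (by norm_num)
    _ ≤ 28 * (7 / 8 : ℝ) ^ k := by
        have : (0 : ℝ) ≤ (7 / 8) ^ k := by positivity
        rw [show (1 - 7 / 8 : ℝ) = 1 / 8 by norm_num]
        linarith

theorem exists_uniformPowerset_real_not_centrallyFull_le {ε : ℝ} (hε : 0 < ε) :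
    ∃ k : ℕ, ∀ (U : Finset ℤ) (a b : ℤ), Finset.Icc a b ⊆ U →
      (uniformPowerset U).real {S | ¬ CentrallyFull a b k S} ≤ ε := by
  obtain ⟨k, hk⟩ := exists_pow_lt_of_lt_one (show 0 < ε / 28 by positivity)
    (show (7 / 8 : ℝ) < 1 by norm_num)
  refine ⟨k, fun U a b hU => (uniformPowerset_real_not_centrallyFull_le hU k).trans ?_⟩
  linarith

/-! ### End patterns with prescribed numbers of omissions -/

/-- `A` and `B` are cofinite sets of nonnegative integers for which `A + A` and `B + B` together
omit `s` nonnegative integers and `A + B` omits `e`. -/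
def FringePair (s e : ℕ) (A B : Set ℤ) : Prop :=
  (∀ x ∈ A, 0 ≤ x) ∧ (∀ x ∈ B, 0 ≤ x) ∧
  (∃ k : ℤ, 0 ≤ k ∧ ∀ x, k < x → x ∈ A ∧ x ∈ B) ∧
  ∃ X Y Z : Finset ℤ,
    (∀ x, x ∈ X ↔ 0 ≤ x ∧ ∀ u ∈ A, x - u ∉ A) ∧
    (∀ x, x ∈ Y ↔ 0 ≤ x ∧ ∀ u ∈ B, x - u ∉ B) ∧
    (∀ x, x ∈ Z ↔ 0 ≤ x ∧ ∀ u ∈ A, x - u ∉ B) ∧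
    X.card + Y.card = s ∧ Z.card = e

/-- Translating `A` by 1 moves `A + A` by 2, which newly omits 0 and 1, and moves `A + B` by 1,
which newly omits 0. -/
theorem FringePair.shift {s e : ℕ} {A B : Set ℤ} (h : FringePair s e A B) :
    FringePair (s + 2) (e + 1) {x | x - 1 ∈ A} B := by
  obtain ⟨hA, hB, ⟨k, hk, hAB⟩, X, Y, Z, hX, hY, hZ, hs, he⟩ := h
  refine ⟨fun x hx => ?_, hB, ⟨k + 1, by omega, fun x hx => ⟨(hAB _ (by omega)).1,
    (hAB _ (by omega)).2⟩⟩,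
    insert 0 (insert 1 (X.map (addRightEmbedding 2))), Y,
    insert 0 (Z.map (addRightEmbedding 1)), fun x => ?_, hY, fun x => ?_, ?_, ?_⟩
  · have := hA _ hx
    omega
  · simp only [Finset.mem_insert, Finset.mem_map, addRightEmbedding_apply, Set.mem_ofPred_eq]
    constructor
    · rintro (rfl | rfl | ⟨y, hy, rfl⟩)
      · refine ⟨le_rfl, fun u hu hv => ?_⟩
        have := hA _ hu
        have := hA _ hv
        omega
      · refine ⟨by omega, fun u hu hv => ?_⟩
        have := hA _ hu
        have := hA _ hv
        omega
      · obtain ⟨h0, h1⟩ := (hX y).1 hy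
        refine ⟨by omega, fun u hu hv => h1 _ hu ?_⟩
        convert hv using 1
        ring
    · rintro ⟨h0, h1⟩
      by_cases hx : x = 0
      · exact Or.inl hx
      by_cases hx1 : x = 1
      · exact Or.inr (Or.inl hx1)
      refine Or.inr (Or.inr ⟨x - 2, (hX _).2 ⟨by omega, fun u hu hv => ?_⟩, by ring⟩)
      refine h1 (u + 1) (by simpa using hu) ?_
      convert hv using 1
      ring
  · simp only [Finset.mem_insert, Finset.mem_map, addRightEmbedding_apply, Set.mem_ofPred_eq]
    constructor
    · rintro (rfl | ⟨y, hy, rfl⟩)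
      · refine ⟨le_rfl, fun u hu hv => ?_⟩
        have := hA _ hu
        have := hB _ hv
        omega
      · obtain ⟨h0, h1⟩ := (hZ y).1 hy
        refine ⟨by omega, fun u hu hv => h1 _ hu ?_⟩
        convert hv using 1
        ring
    · rintro ⟨h0, h1⟩
      by_cases hx : x = 0
      · exact Or.inl hx
      refine Or.inr ⟨x - 1, (hZ _).2 ⟨by omega, fun u hu hv => ?_⟩, by ring⟩
      refine h1 (u + 1) (by simpa using hu) ?_
      convert hv using 1
      ring
  · have h0 : ∀ y ∈ X, 0 ≤ y := fun y hy => ((hX y).1 hy).1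
    rw [Finset.card_insert_of_notMem, Finset.card_insert_of_notMem, Finset.card_map]
    · omega
    · simp only [Finset.mem_map, addRightEmbedding_apply, not_exists, not_and]
      intro y hy
      have := h0 y hy
      omega
    · simp only [Finset.mem_insert, Finset.mem_map, addRightEmbedding_apply]
      rintro (h | ⟨y, hy, h⟩)
      · omega
      · have := h0 y hy
        omega
  · have h0 : ∀ y ∈ Z, 0 ≤ y := fun y hy => ((hZ y).1 hy).1
    rw [Finset.card_insert_of_notMem, Finset.card_map, he]
    simp only [Finset.mem_map, addRightEmbedding_apply, not_exists, not_and]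
    intro y hy
    have := h0 y hy
    omega

theorem exists_fringePair_zero (s : ℕ) : ∃ A B, FringePair s 0 A B := by
  refine ⟨{x | 0 ≤ x}, {x | x = 0 ∨ s < x}, fun x hx => hx, ?_, ⟨s, by omega, ?_⟩,
    ∅, Finset.Icc 1 s, ∅, ?_, ?_, ?_, by simp, by simp⟩
  · rintro x (hx | hx) <;> omega
  · intro x hx
    exact ⟨by simp only [Set.mem_ofPred_eq]; omega, Or.inr hx⟩
  · intro x
    simp only [Finset.notMem_empty, Set.mem_ofPred_eq, false_iff, not_and, not_forall, not_not]
    exact fun hx => ⟨0, le_rfl, by omega⟩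
  · intro x
    simp only [Finset.mem_Icc, Set.mem_ofPred_eq]
    constructor
    · intro hx
      exact ⟨by omega, fun u hu => by omega⟩
    · rintro ⟨h0, h1⟩
      have := h1 0 (Or.inl rfl)
      omega
  · intro x
    simp only [Finset.notMem_empty, Set.mem_ofPred_eq, false_iff, not_and, not_forall, not_not]
    exact fun hx => ⟨x, hx, by omega⟩

/-- Below the cut-off, `B` consists of the residues 0 and 1 modulo 3, followed by a gap up to `N`;
`B + B` still covers everything. The set `A` is mostly multiples of 3, so residue 2 in `A + B` comes
only from the small elements 1, 2, 4 or from beyond `N`. These cannot cross the gap, leaving exactly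
`e` omissions. Dropping 1 from `A` makes `A + A` omit just 1. -/
theorem exists_fringePair_of_le_one (δ e : ℕ) (hδ : δ ≤ 1) : ∃ A B, FringePair δ e A B := by
  -- `N` is 2 modulo 3, and large enough that `3 * (e + 1) + 1` lies in the initial part of `B`.
  set N : ℤ := 6 * e + 20 with hN
  refine ⟨{x | x = 2 ∨ x = 4 ∨ (x = 1 ∧ δ = 0) ∨ (0 ≤ x ∧ x % 3 = 0) ∨ N < x},
    {x | (0 ≤ x ∧ x ≤ N - 3 * e - 2 ∧ x % 3 ≠ 2) ∨ N < x}, ?_, ?_, ⟨N, by omega, ?_⟩,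
    if δ = 0 then ∅ else {1}, ∅,
    (Finset.range e).image (fun j : ℕ => N - 3 * j), ?_, ?_, ?_, ?_, ?_⟩
  · intro x hx
    simp only [Set.mem_ofPred_eq] at hx
    omega
  · intro x hx
    simp only [Set.mem_ofPred_eq] at hx
    omega
  · intro x hx
    simp only [Set.mem_ofPred_eq]
    omega
  · intro x
    have hmem : x ∈ (if δ = 0 then (∅ : Finset ℤ) else {1}) ↔ x = 1 ∧ δ = 1 := by
      split_ifs with h
      · simp [h]
      · simp [show δ = 1 by omega]
    rw [hmem]
    simp only [Set.mem_ofPred_eq]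
    constructor
    · rintro ⟨rfl, h⟩
      refine ⟨by omega, fun u hu => ?_⟩
      omega
    · rintro ⟨h0, h1⟩
      have a0 := h1 0 (by omega)
      have a2 := h1 2 (by omega)
      have a4 := h1 4 (by omega)
      by_cases hδ0 : δ = 0
      · have a1 := h1 1 (by omega)
        omega
      · omega
  · intro x
    simp only [Finset.notMem_empty, Set.mem_ofPred_eq, false_iff, not_and, not_forall, not_not]
    intro hx
    by_cases h : x % 3 = 0
    · by_cases h' : x ≤ N - 3 * e - 2
      · exact ⟨0, by omega, by omega⟩
      · by_cases h'' : x ≤ N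
        · exact ⟨3 * (e + 1), by omega, by omega⟩
        · exact ⟨0, by omega, by omega⟩
    by_cases h1 : x % 3 = 1
    · by_cases h' : x ≤ N - 3 * e - 2
      · exact ⟨0, by omega, by omega⟩
      · by_cases h'' : x ≤ N
        · exact ⟨3 * (e + 1), by omega, by omega⟩
        · exact ⟨0, by omega, by omega⟩
    by_cases h' : x ≤ N - 3 * e - 2
    · exact ⟨1, by omega, by omega⟩
    · by_cases h'' : x ≤ N
      · exact ⟨3 * (e + 1) + 1, by omega, by omega⟩
      · exact ⟨0, by omega, by omega⟩
  · intro x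
    simp only [Finset.mem_image, Finset.mem_range, Set.mem_ofPred_eq]
    constructor
    · rintro ⟨j, hj, rfl⟩
      exact ⟨by omega, fun u hu => by omega⟩
    · rintro ⟨h0, h1⟩
      by_contra hne
      have hne' : ¬ (N - 3 * e < x ∧ x ≤ N ∧ x % 3 = 2) := fun h =>
        hne ⟨((N - x) / 3).toNat, by omega, by omega⟩
      -- The summand 0 reaches residues 0 and 1 before the gap and everything beyond `N`; 2 reaches
      -- residue 2 up to `N - 3 * e`; `3 * (e + 1)` carries residues 0 and 1 across the gap.
      have a0 := h1 0 (by omega)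
      have a2 := h1 2 (by omega)
      have a3 := h1 (3 * (e + 1)) (by omega)
      omega
  · split_ifs with h
    · simp [h]
    · simp [show δ = 1 by omega]
  · rw [Finset.card_image_of_injective _ (fun i j h => by simpa using h), Finset.card_range]

/-- Shifting lowers `(s, e)` by `(2, 1)` until `e = 0` or `s ≤ 1`. -/
theorem exists_fringePair (s e : ℕ) : ∃ A B, FringePair s e A B := by
  induction e generalizing s with
  | zero => exact exists_fringePair_zero s
  | succ e ih =>
    by_cases hs : s ≤ 1
    · exact exists_fringePair_of_le_one s _ hs
    · obtain ⟨A, B, h⟩ := ih (s - 2)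
      have := h.shift
      rw [show s - 2 + 2 = s by omega] at this
      exact ⟨_, _, this⟩

/-! ### The fringe determines the missing counts -/

/-- The elements of `[0, n]` at distance at most `k` from an end. -/
noncomputable def fringe (n : ℕ) (k : ℕ) : Finset ℤ :=
  (Finset.Icc 0 (n : ℤ)).filter (fun x => x ≤ k ∨ (n : ℤ) - k ≤ x)

theorem mem_fringe {n k : ℕ} {x : ℤ} :
    x ∈ fringe n k ↔ (0 ≤ x ∧ x ≤ n) ∧ (x ≤ k ∨ (n : ℤ) - k ≤ x) := by
  simp [fringe]

theorem fringe_subset (n k : ℕ) : fringe n k ⊆ Finset.Icc 0 (n : ℤ) := Finset.filter_subset _ _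

theorem card_fringe_le (n k : ℕ) : (fringe n k).card ≤ 2 * (k + 1) := by
  have h : fringe n k ⊆ Finset.Icc 0 (k : ℤ) ∪ Finset.Icc ((n : ℤ) - k) n := by
    intro x hx
    rw [mem_fringe] at hx
    simp only [Finset.mem_union, Finset.mem_Icc]
    omega
  have h1 := (Finset.card_le_card h).trans (Finset.card_union_le _ _)
  rw [Int.card_Icc, Int.card_Icc] at h1
  omega

/-- Adding elements outside the fringe to a centrally full set creates neither new sums nor new
differences. -/
theorem missing_eq_of_subset {n k : ℕ} {S T : Finset ℤ} (hST : S ⊆ T)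
    (hT : T ⊆ Finset.Icc 0 (n : ℤ)) (hF : ∀ x ∈ fringe n k, x ∈ T → x ∈ S)
    (hS : CentrallyFull 0 n (k + 1) S) (hkn : 2 * k + 2 ≤ n) :
    missing n S = missing n T := by
  have hT' : ∀ x ∈ T, 0 ≤ x ∧ x ≤ n := fun x hx => Finset.mem_Icc.1 (hT hx)
  have hF' : ∀ x ∈ T, x ≤ k ∨ (n : ℤ) - k ≤ x → x ∈ S := fun x hx h =>
    hF x (mem_fringe.2 ⟨hT' x hx, h⟩) hx
  obtain ⟨hsum, hdiff⟩ := hS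
  push_cast at hsum hdiff
  have hadd : S + S = T + T := by
    refine (Finset.add_subset_add hST hST).antisymm fun x hx => ?_
    obtain ⟨u, hu, v, hv, rfl⟩ := Finset.mem_add.1 hx
    have hu' := hT' u hu
    have hv' := hT' v hv
    by_cases h1 : u + v ≤ k
    · exact Finset.add_mem_add (hF' u hu (by omega)) (hF' v hv (by omega))
    by_cases h2 : 2 * (n : ℤ) - k ≤ u + v
    · exact Finset.add_mem_add (hF' u hu (by omega)) (hF' v hv (by omega))
    obtain ⟨w, hw, hw', -⟩ := hsum (u + v) (by omega) (by omega)
    exact Finset.mem_add.2 ⟨w, hw, _, hw', by ring⟩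
  have hpos : ∀ u ∈ T, ∀ v ∈ T, 0 < v - u → ∃ u' ∈ S, ∃ v' ∈ S, v' - u' = v - u := by
    intro u hu v hv h
    have hu' := hT' u hu
    have hv' := hT' v hv
    by_cases h1 : (n : ℤ) - k ≤ v - u
    · exact ⟨u, hF' u hu (by omega), v, hF' v hv (by omega), rfl⟩
    · obtain ⟨w, hw, hw', -⟩ := hdiff (v - u) (by omega) (by omega)
      exact ⟨w, hw, _, hw', by ring⟩
  have hsub : S - S = T - T := by
    refine (Finset.sub_subset_sub hST hST).antisymm fun x hx => ?_
    obtain ⟨v, hv, u, hu, rfl⟩ := Finset.mem_sub.1 hx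
    rcases lt_trichotomy u v with h | rfl | h
    · obtain ⟨u', hu', v', hv', he⟩ := hpos u hu v hv (by omega)
      exact Finset.mem_sub.2 ⟨v', hv', u', hu', he⟩
    -- The difference 0 only needs `S` to be nonempty, which any attained sum shows.
    · obtain ⟨w, hw, -⟩ := hsum (k + 1) (by omega) (by omega)
      exact Finset.mem_sub.2 ⟨w, hw, w, hw, by ring⟩
    · obtain ⟨v', hv', u', hu', he⟩ := hpos v hv u hu (by omega)
      exact Finset.mem_sub.2 ⟨v', hv', u', hu', by omega⟩
  rw [missing, missing, hadd, hsub]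

open Classical in
/-- The subset of `[0, n]` with left fringe `A` and reflected right fringe `B`. -/
noncomputable def fringeSet (A B : Set ℤ) (n : ℕ) : Finset ℤ :=
  (Finset.Icc 0 (n : ℤ)).filter (fun x => x ∈ A ∧ (n : ℤ) - x ∈ B)

theorem mem_fringeSet {A B : Set ℤ} {n : ℕ} {x : ℤ} :
    x ∈ fringeSet A B n ↔ (0 ≤ x ∧ x ≤ n) ∧ x ∈ A ∧ (n : ℤ) - x ∈ B := by
  simp [fringeSet]

/-- Small sums are those of `A + A`, and sums near `2 * n` reflect `B + B`. Since `n - (v - u) = u +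
(n - v)`, differences near `n` reflect `A + B`; by symmetry each omission there counts twice. -/
theorem FringePair.eventually_missing_fringeSet {s e : ℕ} {A B : Set ℤ} (h : FringePair s e A B) :
    ∀ᶠ n : ℕ in atTop, missing n (fringeSet A B n) = (s, 2 * e) := by
  obtain ⟨hA, hB, ⟨k, hk, hAB⟩, X, Y, Z, hX, hY, hZ, hs, he⟩ := h
  filter_upwards [eventually_gt_atTop (4 * k + 10).toNat] with n hn
  have hX' : ∀ x ∈ X, 0 ≤ x ∧ x < 2 * k + 2 := by
    intro x hx
    obtain ⟨h0, h1⟩ := (hX x).1 hx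
    refine ⟨h0, ?_⟩
    by_contra hcon
    exact h1 (k + 1) (hAB _ (by omega)).1 (hAB _ (by omega)).1
  have hY' : ∀ x ∈ Y, 0 ≤ x ∧ x < 2 * k + 2 := by
    intro x hx
    obtain ⟨h0, h1⟩ := (hY x).1 hx
    refine ⟨h0, ?_⟩
    by_contra hcon
    exact h1 (k + 1) (hAB _ (by omega)).2 (hAB _ (by omega)).2
  have hZ' : ∀ x ∈ Z, 0 ≤ x ∧ x < 2 * k + 2 := by
    intro x hx
    obtain ⟨h0, h1⟩ := (hZ x).1 hx
    refine ⟨h0, ?_⟩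
    by_contra hcon
    exact h1 (k + 1) (hAB _ (by omega)).1 (hAB _ (by omega)).2
  set S := fringeSet A B n with hS
  have hmem : ∀ x, k < x → x < n - k → x ∈ S := fun x h1 h2 =>
    mem_fringeSet.2 ⟨⟨by omega, by omega⟩, (hAB _ h1).1, (hAB _ (by omega)).2⟩
  have hleft : ∀ x ∈ A, x < n - k → x ∈ S := fun x h1 h2 =>
    mem_fringeSet.2 ⟨⟨hA x h1, by omega⟩, h1, (hAB _ (by omega)).2⟩
  have hright : ∀ x ∈ B, x < n - k → n - x ∈ S := fun x h1 h2 =>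
    mem_fringeSet.2 ⟨⟨by omega, by have := hB x h1; omega⟩, (hAB _ (by omega)).1, by simpa using h1⟩
  have hadd : S + S = Finset.Icc 0 (2 * (n : ℤ)) \ (X ∪ Y.image (fun y => 2 * (n : ℤ) - y)) := by
    ext x
    rw [Finset.mem_add, Finset.mem_sdiff, Finset.mem_Icc, Finset.mem_union, Finset.mem_image, not_or]
    constructor
    · rintro ⟨u, hu, v, hv, rfl⟩
      obtain ⟨hu0, huA, huB⟩ := mem_fringeSet.1 hu
      obtain ⟨hv0, hvA, hvB⟩ := mem_fringeSet.1 hv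
      refine ⟨⟨by omega, by omega⟩, fun hx => ?_, ?_⟩
      · exact ((hX _).1 hx).2 u huA (by simpa using hvA)
      · rintro ⟨y, hy, hyx⟩
        refine ((hY _).1 hy).2 _ huB ?_
        convert hvB using 1
        omega
    · rintro ⟨hx, hxX, hxY⟩
      by_cases h1 : x ≤ 2 * k + 2
      · rw [hX] at hxX
        push Not at hxX
        obtain ⟨u, hu, hv⟩ := hxX hx.1
        have := hA _ hu
        have := hA _ hv
        exact ⟨u, hleft u hu (by omega), _, hleft _ hv (by omega), by ring⟩
      by_cases h2 : 2 * (n : ℤ) - x ≤ 2 * k + 2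
      · have h3 : 2 * (n : ℤ) - x ∉ Y := fun h => hxY ⟨_, h, by ring⟩
        rw [hY] at h3
        push Not at h3
        obtain ⟨u, hu, hv⟩ := h3 (by omega)
        have := hB _ hu
        have := hB _ hv
        exact ⟨_, hright u hu (by omega), _, hright _ hv (by omega), by ring⟩
      · exact ⟨x / 2, hmem _ (by omega) (by omega), x - x / 2, hmem _ (by omega) (by omega), by ring⟩
  have hdiff : ∀ x : ℤ, 0 ≤ x → x ≤ n → (n : ℤ) - x ∉ Z → ∃ u ∈ S, ∃ v ∈ S, v - u = x := by
    intro x h0 hn' hx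
    by_cases h1 : (n : ℤ) - x ≤ 2 * k + 2
    · rw [hZ] at hx
      push Not at hx
      obtain ⟨u, hu, hv⟩ := hx (by omega)
      have := hA _ hu
      have := hB _ hv
      exact ⟨u, hleft u hu (by omega), _, hright _ hv (by omega), by ring⟩
    · exact ⟨k + 1, hmem _ (by omega) (by omega), k + 1 + x, hmem _ (by omega) (by omega), by ring⟩
  have hndiff : ∀ u ∈ S, ∀ v ∈ S, n - (v - u) ∉ Z := by
    intro u hu v hv hz
    obtain ⟨hu0, huA, huB⟩ := mem_fringeSet.1 hu
    obtain ⟨hv0, hvA, hvB⟩ := mem_fringeSet.1 hv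
    refine ((hZ _).1 hz).2 _ huA ?_
    convert hvB using 1
    ring
  have hsub : S - S = Finset.Icc (-(n : ℤ)) n \
      (Z.image (fun z => (n : ℤ) - z) ∪ Z.image (fun z => z - (n : ℤ))) := by
    ext x
    rw [Finset.mem_sub, Finset.mem_sdiff, Finset.mem_Icc, Finset.mem_union, Finset.mem_image,
      Finset.mem_image, not_or]
    constructor
    · rintro ⟨v, hv, u, hu, rfl⟩
      obtain ⟨hu0, -⟩ := mem_fringeSet.1 hu
      obtain ⟨hv0, -⟩ := mem_fringeSet.1 hv
      refine ⟨⟨by omega, by omega⟩, ?_, ?_⟩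
      · rintro ⟨z, hz, hzx⟩
        refine hndiff u hu v hv ?_
        rwa [← hzx, sub_sub_cancel]
      · rintro ⟨z, hz, hzx⟩
        refine hndiff v hv u hu ?_
        convert hz using 1
        omega
    · rintro ⟨hx, hx1, hx2⟩
      by_cases h0 : 0 ≤ x
      · obtain ⟨u, hu, v, hv, he⟩ := hdiff x h0 hx.2 fun h => hx1 ⟨_, h, by ring⟩
        exact ⟨v, hv, u, hu, he⟩
      · obtain ⟨u, hu, v, hv, he⟩ := hdiff (-x) (by omega) (by omega) fun h => hx2 ⟨_, h, by ring⟩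
        exact ⟨u, hu, v, hv, by omega⟩
  have hcadd : (S + S).card = 2 * n + 1 - s := by
    rw [hadd, Finset.card_sdiff_of_subset, Finset.card_union_of_disjoint,
      Finset.card_image_of_injective _ (sub_right_injective), hs, Int.card_Icc]
    · omega
    · rw [Finset.disjoint_left]
      intro x hx hy
      obtain ⟨y, hyY, rfl⟩ := Finset.mem_image.1 hy
      have := hX' _ hx
      have := hY' _ hyY
      omega
    · intro x hx
      rw [Finset.mem_Icc]
      rcases Finset.mem_union.1 hx with hx | hx
      · have := hX' _ hx
        omega
      · obtain ⟨y, hy, rfl⟩ := Finset.mem_image.1 hx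
        have := hY' _ hy
        omega
  have hcsub : (S - S).card = 2 * n + 1 - 2 * e := by
    rw [hsub, Finset.card_sdiff_of_subset, Finset.card_union_of_disjoint,
      Finset.card_image_of_injective _ (sub_right_injective),
      Finset.card_image_of_injective _ (sub_left_injective), he, Int.card_Icc]
    · omega
    · rw [Finset.disjoint_left]
      intro x hx hy
      obtain ⟨y, hyZ, rfl⟩ := Finset.mem_image.1 hx
      obtain ⟨z, hz, hyz⟩ := Finset.mem_image.1 hy
      have := hZ' _ hyZ
      have := hZ' _ hz
      omega
    · intro x hx
      rw [Finset.mem_Icc]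
      rcases Finset.mem_union.1 hx with hx | hx
      · obtain ⟨y, hy, rfl⟩ := Finset.mem_image.1 hx
        have := hZ' _ hy
        omega
      · obtain ⟨y, hy, rfl⟩ := Finset.mem_image.1 hx
        have := hZ' _ hy
        omega
  -- The omissions are few compared with `n`, so the natural subtractions are not truncated.
  have bound : ∀ W : Finset ℤ, (∀ x ∈ W, 0 ≤ x ∧ x < 2 * k + 2) → (W.card : ℤ) ≤ 2 * k + 2 := by
    intro W hW
    have := Finset.card_le_card (show W ⊆ Finset.Ico 0 (2 * k + 2) from fun x hx =>
      Finset.mem_Ico.2 (hW x hx))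
    rw [Int.card_Ico] at this
    omega
  have b1 := bound X hX'
  have b2 := bound Y hY'
  have b3 := bound Z hZ'
  rw [missing, hcadd, hcsub]
  exact Prod.ext (by dsimp only; omega) (by dsimp only; omega)

/-! ### A lower bound for the conditioning event -/

theorem uniformPowerset_real_mono {U : Finset ℤ} {p q : Finset ℤ → Prop}
    (h : ∀ S ⊆ U, p S → q S) :
    (uniformPowerset U).real {S | p S} ≤ (uniformPowerset U).real {S | q S} := by
  rw [uniformPowerset_real, uniformPowerset_real]
  have := subsetCount_mono h
  gcongr

/-- The middle is centrally full with probability at least `1 / 2`, and overwriting at most `2 * (K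
+ 1)` fringe elements costs the remaining factor. The result lies inside `fringeSet A B n` with the
same fringe, so the missing counts agree. -/
theorem FringePair.exists_le_uniformPowerset_real {s e : ℕ} {A B : Set ℤ}
    (h : FringePair s e A B) :
    ∃ c : ℝ, 0 < c ∧ ∀ᶠ n : ℕ in atTop,
      c ≤ (uniformPowerset (Finset.Icc 0 (n : ℤ))).real {S | missing n S = (s, 2 * e)} := by
  have hev := h.eventually_missing_fringeSet
  obtain ⟨-, -, ⟨l, hl, hAB⟩, -⟩ := h
  obtain ⟨m, rfl⟩ := Int.eq_ofNat_of_zero_le hl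
  obtain ⟨k, hk⟩ := exists_uniformPowerset_real_not_centrallyFull_le (ε := 1 / 2) (by norm_num)
  -- Fullness on `[m + 1, n - m - 1]` with margin `k` is fullness on `[0, n]` with margin `2 * (m +
  -- 1) + k = K + 1`.
  set K := 2 * m + k + 1 with hK
  refine ⟨1 / 2 / 2 ^ (2 * (K + 1)), by positivity, ?_⟩
  filter_upwards [hev, eventually_ge_atTop (2 * K + 2)] with n hn hnK
  have hgood : 1 / 2 ≤ (uniformPowerset (Finset.Icc 0 (n : ℤ))).real
      {S | CentrallyFull (m + 1) (n - m - 1) k S} := by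
    have h1 := hk (Finset.Icc 0 (n : ℤ)) (m + 1) (n - m - 1)
      (Finset.Icc_subset_Icc (by omega) (by omega))
    have h2 := probReal_compl_eq_one_sub (μ := uniformPowerset (Finset.Icc 0 (n : ℤ)))
      (s := {S | CentrallyFull (m + 1) (n - m - 1) k S}) trivial
    have h3 : {S | CentrallyFull (m + 1) (n - m - 1) k S}ᶜ
      = {S | ¬ CentrallyFull (m + 1) ((n : ℤ) - m - 1) k S} := rfl
    rw [h3] at h2
    linarith
  have hrep := uniformPowerset_real_le_of_replace (S₀ := fringeSet A B n) (fringe_subset n K)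
    (p := fun S => CentrallyFull (m + 1) (n - m - 1) k S)
    (q := fun S => missing n S = (s, 2 * e)) ?_
  · rw [div_le_iff₀ (by positivity), mul_comm]
    refine hgood.trans (hrep.trans ?_)
    gcongr
    · norm_num
    · exact card_fringe_le n K
  · intro S hSU hS
    have hin : ∀ x : ℤ, m < x → x < n - m → x ∈ fringeSet A B n := fun x h1 h2 =>
      mem_fringeSet.2 ⟨⟨by omega, by omega⟩, (hAB _ h1).1, (hAB _ (by omega)).2⟩
    have hmem : ∀ x ∈ S, (m : ℤ) + 1 ≤ x → x ≤ n - m - 1 →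
        x ∈ S \ fringe n K ∪ fringeSet A B n ∩ fringe n K := by
      intro x hx h1 h2
      have := hin x (by omega) (by omega)
      simp only [Finset.mem_union, Finset.mem_sdiff, Finset.mem_inter]
      tauto
    rw [← hn]
    refine missing_eq_of_subset (k := K) ?_
      (fun x hx => Finset.mem_Icc.2 (mem_fringeSet.1 hx).1) ?_ ?_ hnK
    · intro x hx
      rcases Finset.mem_union.1 hx with hx | hx
      · obtain ⟨hxS, hxF⟩ := Finset.mem_sdiff.1 hx
        have := Finset.mem_Icc.1 (hSU hxS)
        rw [mem_fringe] at hxF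
        exact hin x (by omega) (by omega)
      · exact (Finset.mem_inter.1 hx).1
    · intro x hxF hx
      exact Finset.mem_union_right _ (Finset.mem_inter.2 ⟨hx, hxF⟩)
    · refine ⟨fun x h1 h2 => ?_, fun x h1 h2 => ?_⟩
      · push_cast at h1 h2
        obtain ⟨u, hu, hv, b1, b2, b3, b4⟩ := hS.1 x (by omega) (by omega)
        exact ⟨u, hmem u hu b1 b2, hmem _ hv b3 b4, by omega, by omega, by omega, by omega⟩
      · push_cast at h2
        obtain ⟨u, hu, hv, b1, b2⟩ := hS.2 x (by omega) (by omega)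
        exact ⟨u, hmem u hu b1 (by omega), hmem _ hv (by omega) b2, by omega, by omega⟩

/-! ### Asymptotic independence and the limit -/

/-- An event determined by the middle of a random set is asymptotically independent of the event
`λ_n(S) ∈ Λ`. -/
theorem abs_uniformPowerset_real_inter_sub_mul_le {n k : ℕ} {ε : ℝ} {L : Set (ℕ × ℕ)}
    {E : Set (Finset ℤ)} {a : ℤ} (hka : (k : ℤ) ≤ a) (hkn : 2 * k + 2 ≤ n)
    (hk : (uniformPowerset (Finset.Icc 0 (n : ℤ))).real {S | ¬ CentrallyFull 0 n k S} ≤ ε)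
    (hE : DependsOnlyOnInter n (Finset.Icc (a + 1) ((n : ℤ) - a - 1)) E) :
    |(uniformPowerset (Finset.Icc 0 (n : ℤ))).real {S | S ∈ E ∧ missing n S ∈ L}
      - (uniformPowerset (Finset.Icc 0 (n : ℤ))).real {S | S ∈ E}
        * (uniformPowerset (Finset.Icc 0 (n : ℤ))).real {S | missing n S ∈ L}| ≤ 2 * ε := by
  set U := Finset.Icc 0 (n : ℤ) with hU
  set μ := uniformPowerset U
  set J := Finset.Icc (a + 1) ((n : ℤ) - a - 1) with hJ
  have hJU : J ⊆ U := Finset.Icc_subset_Icc (by omega) (by omega)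
  have hJF : J ⊆ U \ fringe n k := by
    intro x hx
    have h1 := Finset.mem_Icc.1 hx
    rw [Finset.mem_sdiff, mem_fringe]
    exact ⟨hJU hx, by omega⟩
  -- Filling in everything outside the fringe gives a proxy for `missing n S ∈ L` that ignores the
  -- middle and agrees with it on centrally full sets.
  let q : Finset ℤ → Prop := fun S => missing n (S ∪ U \ fringe n k) ∈ L
  have hind : μ.real {S | S ∈ E ∧ q S} = μ.real {S | S ∈ E} * μ.real {S | q S} := by
    refine uniformPowerset_real_inter hJU (fun S hS => ?_) (fun S hS => ?_)
    · refine hE S (S ∩ J) hS (Finset.inter_subset_left.trans hS) ?_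
      rw [Finset.inter_assoc, Finset.inter_self]
    · have : S \ J ∪ U \ fringe n k = S ∪ U \ fringe n k := by
        ext x
        have := @hJF x
        simp only [Finset.mem_union, Finset.mem_sdiff] at this ⊢
        tauto
      simp only [q, this]
  have hiff : ∀ S ⊆ U, CentrallyFull 0 n k S → (missing n S ∈ L ↔ q S) := by
    intro S hS hG
    have : missing n S = missing n (S ∪ U \ fringe n k) := by
      refine missing_eq_of_subset (k := k) Finset.subset_union_left
        (Finset.union_subset hS Finset.sdiff_subset) (fun x hxF hx => ?_) ?_ hkn
      · rcases Finset.mem_union.1 hx with hx | hx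
        · exact hx
        · exact absurd hxF (Finset.mem_sdiff.1 hx).2
      · refine ⟨fun x h1 h2 => hG.1 x ?_ ?_, fun x h1 h2 => hG.2 x h1 ?_⟩ <;> push_cast at * <;>
          omega
    simp only [q, this]
  have hle : ∀ p r : Finset ℤ → Prop, (∀ S ⊆ U, CentrallyFull 0 n k S → p S → r S) →
      μ.real {S | p S} ≤ μ.real {S | r S} + ε := by
    intro p r hpr
    have h1 : μ.real {S | p S} ≤ μ.real {S | r S ∨ ¬ CentrallyFull 0 n k S} :=
      uniformPowerset_real_mono fun S hS hp => by
        by_cases hG : CentrallyFull 0 n k S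
        · exact Or.inl (hpr S hS hG hp)
        · exact Or.inr hG
    have h2 := measureReal_union_le (μ := μ) {S | r S} {S | ¬ CentrallyFull 0 n k S}
    exact h1.trans (h2.trans (by linarith))
  have h1 := hle (fun S => missing n S ∈ L) q fun S hS hG => (hiff S hS hG).1
  have h2 := hle q (fun S => missing n S ∈ L) fun S hS hG => (hiff S hS hG).2
  have h3 := hle (fun S => S ∈ E ∧ missing n S ∈ L) (fun S => S ∈ E ∧ q S)
    fun S hS hG => And.imp_right (hiff S hS hG).1
  have h4 := hle (fun S => S ∈ E ∧ q S) (fun S => S ∈ E ∧ missing n S ∈ L)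
    fun S hS hG => And.imp_right (hiff S hS hG).2
  have h5 : μ.real {S | S ∈ E} ≤ 1 := measureReal_le_one
  have h6 : 0 ≤ μ.real {S | S ∈ E} := measureReal_nonneg
  rw [hind] at h3 h4
  rw [abs_le]
  constructor <;> nlinarith

theorem mainTheorem5
    (Λ : Set (ℕ × ℕ)) (hΛ : ∃ s d : ℕ, (s, d) ∈ Λ ∧ Even d)
    (α : ℕ → ℤ)
    (hα : ∀ᶠ n : ℕ in atTop, 0 < α n ∧ (α n : ℝ) < (n : ℝ) / 2)
    (hα' : Tendsto α atTop atTop)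
    (E : ℕ → Set (Finset ℤ))
    (hE : ∀ᶠ n : ℕ in atTop,
      DependsOnlyOnInter n (Finset.Icc (α n + 1) ((n : ℤ) - α n - 1)) (E n))
    (ℓ : ℝ)
    (hℓ : Tendsto (fun n : ℕ => (uniformSubset n).real (E n)) atTop (𝓝 ℓ)) :
    (∀ᶠ n : ℕ in atTop, 0 < (uniformSubset n).real (missingIn n Λ)) ∧
      Tendsto (fun n : ℕ => (cond (uniformSubset n) (missingIn n Λ)).real (E n))
        atTop (𝓝 ℓ) := by
  obtain ⟨s, d, hsd, e, he⟩ := hΛ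
  obtain ⟨A, B, hAB⟩ := exists_fringePair s e
  obtain ⟨c, hc, hcn⟩ := hAB.exists_le_uniformPowerset_real
  have hM : ∀ᶠ n : ℕ in atTop, c ≤ (uniformSubset n).real (missingIn n Λ) := by
    filter_upwards [hcn] with n hn
    refine hn.trans (uniformPowerset_real_mono fun S _ hS => ?_)
    rw [hS, ← two_mul] at *
    rwa [← he]
  refine ⟨hM.mono fun n hn => hc.trans_le hn, ?_⟩
  have key : Tendsto (fun n : ℕ => (cond (uniformSubset n) (missingIn n Λ)).real (E n)
      - (uniformSubset n).real (E n)) atTop (𝓝 0) := by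
    rw [Metric.tendsto_nhds]
    intro ε hε
    -- The independence error is then `c * ε / 2`, still below `c * ε`; dividing by a probability at
    -- least `c` leaves less than `ε`.
    obtain ⟨k, hk⟩ := exists_uniformPowerset_real_not_centrallyFull_le
      (ε := c * ε / 4) (by positivity)
    filter_upwards [hM, hE, hα'.eventually_ge_atTop (k : ℤ), eventually_ge_atTop (2 * k + 2)]
      with n hMn hEn hkα hkn
    have h1 := abs_uniformPowerset_real_inter_sub_mul_le (L := Λ) hkα hkn
      (hk (Finset.Icc 0 (n : ℤ)) 0 n le_rfl) hEn
    have h2 : (cond (uniformSubset n) (missingIn n Λ)).real (E n)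
        = (uniformSubset n).real {S | S ∈ E n ∧ missing n S ∈ Λ}
          / (uniformSubset n).real (missingIn n Λ) := by
      rw [measureReal_def, cond_apply (show MeasurableSet (missingIn n Λ) from trivial), ENNReal.toReal_mul, ENNReal.toReal_inv,
        Set.inter_comm, div_eq_inv_mul]
      rfl
    have hpos : 0 < (uniformSubset n).real (missingIn n Λ) := hc.trans_le hMn
    rw [Real.dist_eq, sub_zero, h2, div_sub' hpos.ne', abs_div, abs_of_pos hpos,
      div_lt_iff₀ hpos, mul_comm ((uniformSubset n).real (missingIn n Λ))]
    calc _ ≤ 2 * (c * ε / 4) := h1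
      _ < ε * c := by nlinarith
      _ ≤ _ := by gcongr
  simpa using key.add hℓ
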